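/- For a vector $u\in\mathbb{R}^p$, $u\neq 0$, let $S^-(u)$ be the number of sign changes in $u$ after its zero entries have been deleted, i.e. the number of $i$ with $\tilde u_i\tilde u_{i+1}<0$, where $\tilde u$ is $u$ with all zeros deleted; put $S^-(0):=-1$. For an integer $j\ge 0$, a matrix $X\in\mathbb{R}^{n\times m}$ is called $j$-variation bounding if $S^-(Xu)\le j$ for every $u\in\mathbb{R}^m$, $u\neq 0$, with $S^-(u)\le j$. It is called $k$-sign consistent if all of its $k\times k$ minors (with rows and columns taken in increasing order) are $\ge 0$, or all of them are $\le 0$. Theorem. Let $X\in\mathbb{R}^{n\times m}$ and let $k\ge 1$ be an integer with $k<\operatorname{rank}(X)$ such that any $k$ columns of $X$ (with distinct indices) are linearly independent. Then $X$ is $(k-1)$-variation bounding if and only if $X$ is $k$-sign consistent. -/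

import Mathlib

/-- The number of indices `i` with `l i * l (i + 1) < 0`, i.e. the number of consecutive pairs of
entries of the list that have opposite strict signs. -/
noncomputable def signChanges : List ℝ → ℕ
  | [] => 0
  | [_] => 0
  | a :: b :: l => (if a * b < 0 then 1 else 0) + signChanges (b :: l)

/-- The vector obtained by deleting all zero entries of `u`, in the original order. -/
noncomputable def deleteZeros {n : ℕ} (u : Fin n → ℝ) : List ℝ :=
  (List.ofFn u).filter (fun x => x ≠ 0)

/-- The variation of `u`: the number of sign changes after deleting zeros, with value `-1` at the
zero vector. -/
noncomputable def variation {n : ℕ} (u : Fin n → ℝ) : ℤ :=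
  if u = 0 then -1 else (signChanges (deleteZeros u) : ℤ)

/-- The map `u ↦ X u` is `k`-variation bounding. -/
def IsVariationBounding {n m : ℕ} (X : Matrix (Fin n) (Fin m) ℝ) (k : ℕ) : Prop :=
  ∀ u : Fin m → ℝ, u ≠ 0 → variation u ≤ (k : ℤ) → variation (X.mulVec u) ≤ (k : ℤ)

/-- The `k`-th multiplicative compound matrix: the matrix of all `k × k` minors. Rows and columns
are indexed by the strictly increasing `k`-tuples of row and column indices. -/
noncomputable def compoundMatrix {n m : ℕ} (X : Matrix (Fin n) (Fin m) ℝ) (k : ℕ) :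
    Matrix (Fin k ↪o Fin n) (Fin k ↪o Fin m) ℝ :=
  Matrix.of fun I J => (X.submatrix I J).det

/-- `X` is `k`-sign consistent: its `k`-th compound matrix is entrywise nonnegative or entrywise
nonpositive. -/
def IsSignConsistent {n m : ℕ} (X : Matrix (Fin n) (Fin m) ℝ) (k : ℕ) : Prop :=
  (∀ I J, 0 ≤ compoundMatrix X k I J) ∨ (∀ I J, compoundMatrix X k I J ≤ 0)

/-! A vector has variation at least `q` exactly when it alternates along `q + 1` indices
(`le_variation_iff`), so being `(k-1)`-variation bounding means: whenever `X u` alternates `k`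
times, so does `u`.

Sufficiency: a `u` with fewer than `k` sign changes splits into `k` consecutive blocks of constant
weak sign (`exists_blocks`). Merging the columns of `X` blockwise, with nonnegative weights, gives
an `n × k` matrix `Y` with `X u = Y s`. Its minors are nonnegative combinations of minors of `X`,
hence share a weak sign, and independence of any `k` columns makes one of them nonzero. By
`not_alternates_of_minors_nonneg`, a Gantmacher–Krein type statement, no vector in the column space
of `Y` alternates `k` times.

Necessity: a vector supported on `k` columns cannot alternate `k` times, so neither can its image,
and `minors_nonneg_or_nonpos` gives one weak sign for each `k`-set of columns. Two `k`-sets inside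
`k + 1` independent columns have the same sign by Cramer's rule applied to an alternating right-hand
side (`nonneg_iff_of_independent`). If the `k + 1` columns are dependent, `k < rank X` supplies a
further column outside their span through which the two sets are compared (`nonneg_iff_erase`).
Single exchanges connect all `k`-sets. -/

/-! ### Sign changes as alternations along increasing indices. -/

/-- `v` takes strictly alternating signs along some increasing sequence of `k + 1` indices. -/
def Alternates {ι : Type*} [LinearOrder ι] (v : ι → ℝ) (k : ℕ) : Prop :=
  ∃ r : Fin (k + 1) ↪o ι, ∃ τ : ℝ, ∀ i : Fin (k + 1), 0 < τ * (-1) ^ (i : ℕ) * v (r i)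

/-- If `a` and the entry after `b` have opposite signs, the nonzero `b` is opposite to one of them.
-/
lemma signChanges_cons_le {a b : ℝ} (hb : b ≠ 0) (l : List ℝ) :
    signChanges (a :: l) ≤ signChanges (a :: b :: l) := by
  cases l with
  | nil => simp [signChanges]
  | cons c l =>
    have : (if a * c < 0 then 1 else 0) ≤
        (if a * b < 0 then 1 else 0) + (if b * c < 0 then 1 else 0) := by
      split_ifs with h1 h2 h3 h4 <;> try simp
      have := mul_nonneg (not_lt.1 h2) (not_lt.1 h4)
      have hb2 : 0 < b * b := mul_self_pos.2 hb
      nlinarith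
    simp only [signChanges]
    omega

lemma signChanges_mono_cons {l' l : List ℝ} (h : l'.Sublist l) :
    (∀ x ∈ l, x ≠ 0) → ∀ a : ℝ, signChanges (a :: l') ≤ signChanges (a :: l) := by
  induction h with
  | slnil => intro _ a; exact le_rfl
  | @cons l₁ l₂ b _ ih =>
    intro hl a
    exact (ih (fun x hx => hl x (List.mem_cons_of_mem _ hx)) a).trans
      (signChanges_cons_le (hl b List.mem_cons_self) _)
  | @cons_cons l₁ l₂ b _ ih =>
    intro hl a
    have := ih (fun x hx => hl x (List.mem_cons_of_mem _ hx)) b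
    simp only [signChanges]
    omega

lemma signChanges_le_cons (a : ℝ) (l : List ℝ) : signChanges l ≤ signChanges (a :: l) := by
  cases l with
  | nil => simp [signChanges]
  | cons b l => simp only [signChanges]; omega

lemma signChanges_mono {l' l : List ℝ} (h : l'.Sublist l) (hl : ∀ x ∈ l, x ≠ 0) :
    signChanges l' ≤ signChanges l := by
  induction h with
  | slnil => exact le_rfl
  | @cons l₁ l₂ b _ ih =>
    exact (ih fun x hx => hl x (List.mem_cons_of_mem _ hx)).trans (signChanges_le_cons _ _)
  | @cons_cons l₁ l₂ b h _ =>
    exact signChanges_mono_cons h (fun x hx => hl x (List.mem_cons_of_mem _ hx)) b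

lemma signChanges_of_isChain {l : List ℝ} (h : l.IsChain fun a b => a * b < 0) :
    signChanges l = l.length - 1 := by
  induction l with
  | nil => rfl
  | cons a l ih =>
    cases l with
    | nil => rfl
    | cons b l =>
      rw [List.isChain_cons_cons] at h
      have := ih h.2
      simp only [signChanges, if_pos h.1, this, List.length_cons]
      omega

lemma exists_isChain_sublist (a : ℝ) (l : List ℝ) (hl : ∀ x ∈ a :: l, x ≠ 0) :
    ∃ l' : List ℝ, l'.Sublist l ∧ (a :: l').IsChain (fun a b => a * b < 0) ∧
      l'.length = signChanges (a :: l) := by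
  induction l generalizing a with
  | nil => exact ⟨[], List.Sublist.refl _, by simp, rfl⟩
  | cons b l ih =>
    obtain ⟨l', h1, h2, h3⟩ := ih b fun x hx => hl x (List.mem_cons_of_mem _ hx)
    by_cases hab : a * b < 0
    · refine ⟨b :: l', h1.cons_cons b, List.isChain_cons_cons.2 ⟨hab, h2⟩, ?_⟩
      simp [signChanges, hab, h3, add_comm]
    -- Here `a` and `b` have the same sign, so `a` can replace `b` at the head of the chain.
    · refine ⟨l', h1.cons b, ?_, by simp [signChanges, hab, h3]⟩
      cases l' with
      | nil => simp
      | cons c l' =>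
        rw [List.isChain_cons_cons] at h2 ⊢
        refine ⟨?_, h2.2⟩
        have ha : a ≠ 0 := hl a (by simp)
        have hb : b ≠ 0 := hl b (by simp)
        have hpos : 0 < a * b := lt_of_le_of_ne (not_lt.1 hab) (mul_ne_zero ha hb).symm
        have hbb : 0 < b * b := mul_self_pos.2 hb
        by_contra hc
        have := mul_nonneg hpos.le (not_lt.1 hc)
        have haa : 0 < a * a := mul_self_pos.2 ha
        nlinarith [mul_neg_of_pos_of_neg haa h2.1]

lemma le_signChanges_iff {l : List ℝ} (hl : ∀ x ∈ l, x ≠ 0) (hne : l ≠ []) (k : ℕ) :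
    k ≤ signChanges l ↔ ∃ l' : List ℝ, l'.Sublist l ∧ l'.IsChain (fun a b => a * b < 0) ∧
      l'.length = k + 1 := by
  constructor
  · intro hk
    cases l with
    | nil => exact absurd rfl hne
    | cons a l =>
      obtain ⟨l', h1, h2, h3⟩ := exists_isChain_sublist a l hl
      refine ⟨(a :: l').take (k + 1), (List.take_sublist _ _).trans (h1.cons_cons a), h2.take _, ?_⟩
      simp; omega
  · rintro ⟨l', h1, h2, h3⟩
    have := signChanges_mono h1 hl
    rw [signChanges_of_isChain h2] at this
    omega

lemma deleteZeros_ne_zero {n : ℕ} (u : Fin n → ℝ) : ∀ x ∈ deleteZeros u, x ≠ 0 := by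
  intro x hx
  simpa using (List.mem_filter.1 hx).2

lemma deleteZeros_ne_nil {n : ℕ} {u : Fin n → ℝ} (hu : u ≠ 0) : deleteZeros u ≠ [] := by
  obtain ⟨i, hi⟩ := Function.ne_iff.1 hu
  apply List.ne_nil_of_mem (a := u i)
  exact List.mem_filter.2 ⟨by simp [List.mem_ofFn], by simpa using hi⟩

lemma sublist_ofFn_iff {n : ℕ} (u : Fin n → ℝ) (l : List ℝ) :
    l.Sublist (List.ofFn u) ↔ ∃ f : Fin l.length ↪o Fin n, ∀ i, l.get i = u (f i) := by
  rw [List.sublist_iff_exists_fin_orderEmbedding_get_eq]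
  have hlen : (List.ofFn u).length = n := List.length_ofFn
  constructor
  · rintro ⟨f, hf⟩
    refine ⟨f.trans (Fin.castOrderIso hlen).toOrderEmbedding, fun i => ?_⟩
    rw [hf]; simp; rfl
  · rintro ⟨f, hf⟩
    refine ⟨f.trans (Fin.castOrderIso hlen.symm).toOrderEmbedding, fun i => ?_⟩
    rw [hf]; simp

lemma Alternates.exists_sign {k : ℕ} (v : Fin (k + 1) → ℝ) (h0 : v 0 ≠ 0)
    (hv : ∀ i (hi : i + 1 < k + 1), v ⟨i, Nat.lt_of_succ_lt hi⟩ * v ⟨i + 1, hi⟩ < 0) :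
    ∀ i : Fin (k + 1), 0 < v 0 * (-1) ^ (i : ℕ) * v i := by
  rintro ⟨i, hi⟩
  induction i with
  | zero =>
    have : 0 < v 0 * v 0 := mul_self_pos.2 h0
    simpa using this
  | succ i ih =>
    have h1 := ih (Nat.lt_of_succ_lt hi)
    have h2 := hv i hi
    simp only [pow_succ] at h1 ⊢
    set a := v ⟨i, Nat.lt_of_succ_lt hi⟩
    have ha : a ≠ 0 := by rintro h; simp [h] at h1
    have haa : 0 < a * a := mul_self_pos.2 ha
    by_contra hc
    have := mul_neg_of_pos_of_neg h1 h2
    nlinarith [mul_nonneg (neg_nonneg.2 (not_lt.1 hc)) haa.le]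

/-- The variation is the largest number of sign changes along an increasing sequence of indices. -/
theorem le_variation_iff {n : ℕ} (u : Fin n → ℝ) (k : ℕ) :
    (k : ℤ) ≤ variation u ↔ Alternates u k := by
  by_cases hu : u = 0
  · subst hu
    simp only [variation, if_true, Alternates]
    constructor
    · intro h; omega
    · rintro ⟨r, τ, h⟩
      simpa using h 0
  · simp only [variation, if_neg hu, Nat.cast_le]
    rw [le_signChanges_iff (deleteZeros_ne_zero u) (deleteZeros_ne_nil hu)]
    constructor
    · rintro ⟨l, h1, h2, h3⟩
      obtain ⟨f, hf⟩ := (sublist_ofFn_iff u l).1 (h1.trans List.filter_sublist)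
      let g := (Fin.castOrderIso h3.symm).toOrderEmbedding.trans f
      have hg : ∀ i : Fin (k + 1), u (g i) = l[(i : ℕ)] := fun i => (hf _).symm
      -- Only the sign of `τ` matters, so the first entry itself serves.
      refine ⟨g, u (g 0), Alternates.exists_sign (fun i => u (g i)) ?_ ?_⟩
      · simp only [hg]
        exact deleteZeros_ne_zero u _ (h1.subset (List.getElem_mem _))
      · intro i hi
        simp only [hg]
        exact List.isChain_iff_getElem.1 h2 i (by omega)
    · rintro ⟨r, τ, h⟩
      refine ⟨List.ofFn fun i => u (r i), ?_, ?_, by simp⟩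
      · have : (List.ofFn fun i => u (r i)) =
            (List.ofFn fun i => u (r i)).filter (fun x => x ≠ 0) := by
          symm
          rw [List.filter_eq_self]
          intro x hx
          obtain ⟨i, rfl⟩ := (List.mem_ofFn' _ _).1 hx
          have := h i
          simp only [ne_eq, decide_not, Bool.not_eq_eq_eq_not, Bool.not_true, decide_eq_false_iff_not]
          intro h0; simp [h0] at this
        rw [this]
        refine List.Sublist.filter _ ((sublist_ofFn_iff _ _).2 ⟨(Fin.castOrderIso
          (by simp)).toOrderEmbedding.trans r, fun i => by rw [List.get_ofFn]; rfl⟩)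
      · rw [List.isChain_ofFn]
        intro i hi
        have h1 := h ⟨i, Nat.lt_of_succ_lt hi⟩
        have h2 := h ⟨i + 1, hi⟩
        have h3 := mul_pos h1 h2
        simp only [pow_succ] at h3
        have h4 : ((-1 : ℝ) ^ i) * (-1) ^ i = 1 := by rw [← mul_pow]; simp
        by_contra hc
        have : τ * τ * (u (r ⟨i, Nat.lt_of_succ_lt hi⟩) * u (r ⟨i + 1, hi⟩)) < 0 := by
          linear_combination h3 - τ * τ * (u (r ⟨i, Nat.lt_of_succ_lt hi⟩) * u (r ⟨i + 1, hi⟩)) * h4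
        nlinarith [mul_nonneg (mul_self_nonneg τ) (not_lt.1 hc)]

theorem isVariationBounding_iff {n m : ℕ} (X : Matrix (Fin n) (Fin m) ℝ) (k : ℕ) :
    IsVariationBounding X k ↔
      ∀ u : Fin m → ℝ, u ≠ 0 → Alternates (X.mulVec u) (k + 1) → Alternates u (k + 1) := by
  refine forall₂_congr fun u _ => ?_
  rw [← le_variation_iff, ← le_variation_iff, ← not_imp_not]
  push Not
  push_cast
  simp only [Int.add_one_le_iff]

/-! ### Minors, augmented determinants and hyperplanes. -/

open Matrix

/-- Row rank equals column rank, so some `k` rows are independent; listing them in order gives `f`.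
-/
lemma exists_minor_ne_zero {ι : Type*} [Fintype ι] [LinearOrder ι] {k : ℕ}
    (Y : Matrix ι (Fin k) ℝ) (hY : ∀ c, Y *ᵥ c = 0 → c = 0) :
    ∃ f : Fin k ↪o ι, (Y.submatrix f id).det ≠ 0 := by
  have hcol : LinearIndependent ℝ Y.col := by
    rw [← Matrix.mulVec_injective_iff]
    exact (injective_iff_map_eq_zero Y.mulVecLin).2 hY
  obtain ⟨κ, a, ha, hspan, hli⟩ := exists_linearIndependent' ℝ Y.row
  have : Finite κ := Finite.of_injective a ha
  have := Fintype.ofFinite κ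
  have hcard : Fintype.card κ = k := by
    rw [← finrank_span_eq_card hli, hspan, ← Matrix.rank_eq_finrank_span_row,
      Matrix.rank_eq_finrank_span_cols, finrank_span_eq_card hcol, Fintype.card_fin]
  let s : Finset ι := Finset.univ.image a
  have hs : s.card = k := by
    rw [Finset.card_image_of_injective _ ha, Finset.card_univ, hcard]
  refine ⟨s.orderEmbOfFin hs, ?_⟩
  have hmem : ∀ i, ∃ x, a x = s.orderEmbOfFin hs i := fun i => by
    obtain ⟨x, -, hx⟩ := Finset.mem_image.1 (s.orderEmbOfFin_mem hs i)
    exact ⟨x, hx⟩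
  choose e he using hmem
  have hinj : Function.Injective e := fun i j hij =>
    (s.orderEmbOfFin hs).injective (by rw [← he, ← he, hij])
  have h2 := hli.comp e hinj
  have h3 : (Y.row ∘ a) ∘ e = (Y.submatrix (s.orderEmbOfFin hs) id).row := by
    ext i j
    simp only [Function.comp_apply, he]
    rfl
  rw [h3, Matrix.linearIndependent_rows_iff_isUnit, Matrix.isUnit_iff_isUnit_det] at h2
  exact h2.ne_zero

lemma mulVec_eq_zero_of_minor_ne_zero {ι : Type*} {k : ℕ} {Y : Matrix ι (Fin k) ℝ}
    {f : Fin k → ι} (hf : (Y.submatrix f id).det ≠ 0) {c : Fin k → ℝ}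
    (hc : ∀ i, (Y *ᵥ c) (f i) = 0) : c = 0 :=
  Matrix.eq_zero_of_mulVec_eq_zero hf (funext hc)

/-- The matrix with rows `r i` of `Y` and `v` as an additional first column. -/
def augment {ι : Type*} {k : ℕ} (Y : Matrix ι (Fin k) ℝ) (v : ι → ℝ) (r : Fin (k + 1) → ι) :
    Matrix (Fin (k + 1)) (Fin (k + 1)) ℝ :=
  Matrix.of fun i => Fin.cons (v (r i)) (Y (r i))

lemma augment_mulVec {ι : Type*} {k : ℕ} (Y : Matrix ι (Fin k) ℝ) (v : ι → ℝ)
    (r : Fin (k + 1) → ι) (a : ℝ) (c : Fin k → ℝ) (i : Fin (k + 1)) :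
    (augment Y v r *ᵥ (Fin.cons a c : Fin (k + 1) → ℝ)) i = v (r i) * a + (Y *ᵥ c) (r i) := by
  simp [augment, Matrix.mulVec, dotProduct, Fin.sum_univ_succ]

lemma det_augment {ι : Type*} {k : ℕ} (Y : Matrix ι (Fin k) ℝ) (v : ι → ℝ)
    (r : Fin (k + 1) → ι) :
    (augment Y v r).det =
      ∑ i : Fin (k + 1), (-1) ^ (i : ℕ) * v (r i) * (Y.submatrix (r ∘ i.succAbove) id).det := by
  rw [Matrix.det_succ_column_zero]
  rfl

lemma det_augment_eq_zero {ι : Type*} {k : ℕ} (Y : Matrix ι (Fin k) ℝ) (c : Fin k → ℝ)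
    (r : Fin (k + 1) → ι) : (augment Y (Y *ᵥ c) r).det = 0 := by
  rw [← Matrix.exists_mulVec_eq_zero_iff]
  refine ⟨Fin.cons (-1) c, fun h => ?_, ?_⟩
  · simpa using congrFun h 0
  · ext i
    rw [augment_mulVec]
    simp

/-- A singular augmented matrix gives a relation among its columns. The nonzero minor forces a
nonzero coefficient on `v`, by which one divides. -/
lemma exists_eq_mulVec_of_det_augment {ι : Type*} {k : ℕ} {Y : Matrix ι (Fin k) ℝ} {v : ι → ℝ}
    {r : Fin (k + 1) → ι} (h : (augment Y v r).det = 0) (a : Fin (k + 1))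
    (ha : (Y.submatrix (r ∘ a.succAbove) id).det ≠ 0) :
    ∃ c : Fin k → ℝ, ∀ i, (Y *ᵥ c) (r i) = v (r i) := by
  obtain ⟨w, hw0, hw⟩ := Matrix.exists_mulVec_eq_zero_iff.2 h
  obtain ⟨b, c, rfl⟩ : ∃ b c, w = Fin.cons b c := ⟨w 0, Fin.tail w, (Fin.cons_self_tail w).symm⟩
  have hw' : ∀ i, v (r i) * b + (Y *ᵥ c) (r i) = 0 := fun i => by
    rw [← augment_mulVec, hw]; rfl
  have hb : b ≠ 0 := by
    rintro rfl
    have : c = 0 := mulVec_eq_zero_of_minor_ne_zero ha fun i => by simpa using hw' (a.succAbove i)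
    subst this
    apply hw0
    ext i
    refine Fin.cases ?_ (fun i => ?_) i <;> simp
  refine ⟨(-b⁻¹) • c, fun i => ?_⟩
  rw [Matrix.mulVec_smul, Pi.smul_apply, smul_eq_mul]
  have := hw' i
  field_simp
  linarith

lemma exists_cut {k : ℕ} {ι : Type*} [LinearOrder ι] (g : Fin k ↪o ι) (t : ι) :
    ∃ p : Fin (k + 1), (∀ i : Fin k, i.castSucc < p → g i < t) ∧
      ∀ i : Fin k, p ≤ i.castSucc → t ≤ g i := by
  have h : ∃ p : ℕ, ∀ i : Fin k, p ≤ i → t ≤ g i := ⟨k, fun i hi => absurd i.2 (by omega)⟩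
  classical
  have hk : Nat.find h ≤ k := Nat.find_min' h fun i hi => absurd i.2 (by omega)
  refine ⟨⟨Nat.find h, by omega⟩, fun i hi => ?_, fun i hi => Nat.find_spec h i hi⟩
  have := Nat.find_min h (m := i) hi
  push Not at this
  obtain ⟨j, hj, hlt⟩ := this
  exact (g.monotone (Fin.le_def.2 hj)).trans_lt hlt

/-- The columns of `C` are a basis of the hyperplane `ker ℓ`. -/
lemma exists_kernel_matrix {k : ℕ} (ℓ : (Fin (k + 1) → ℝ) →ₗ[ℝ] ℝ) (hℓ : ℓ ≠ 0) :
    ∃ C : Matrix (Fin (k + 1)) (Fin k) ℝ,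
      (∀ d, C *ᵥ d = 0 → d = 0) ∧ ∀ c, ℓ c = 0 ↔ ∃ d, C *ᵥ d = c := by
  have hfin : Module.finrank ℝ (LinearMap.ker ℓ) = k := by
    have h1 := ℓ.finrank_range_add_finrank_ker
    rw [LinearMap.range_eq_top.2 (LinearMap.surjective hℓ)] at h1
    simp at h1
    omega
  let b := Module.finBasisOfFinrankEq ℝ _ hfin
  let C : Matrix (Fin (k + 1)) (Fin k) ℝ := Matrix.of fun i j => (b j : Fin (k + 1) → ℝ) i
  have hC : ∀ d, C *ᵥ d = (b.equivFun.symm d : LinearMap.ker ℓ) := fun d => by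
    ext i
    simp [C, Matrix.mulVec, dotProduct, Module.Basis.equivFun_symm_apply, mul_comm]
  refine ⟨C, fun d hd => ?_, fun c => ⟨fun hc => ⟨b.equivFun ⟨c, hc⟩, ?_⟩, ?_⟩⟩
  · rw [hC] at hd
    exact b.equivFun.symm.map_eq_zero_iff.1 (Subtype.ext hd)
  · rw [hC]
    simp
  · rintro ⟨d, rfl⟩
    rw [hC]
    exact (b.equivFun.symm d).2

lemma exists_eq_succAboveOrderEmb {k : ℕ} (f : Fin k ↪o Fin (k + 1)) :
    ∃ p : Fin (k + 1), f = p.succAboveOrderEmb := by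
  obtain ⟨p, hp⟩ : ∃ p, p ∉ Set.range f := by
    by_contra h
    push Not at h
    have := Fintype.card_le_of_surjective f h
    simp at this
  refine ⟨p, ?_⟩
  rw [← Finset.orderEmbOfFin_compl_singleton_eq_succAboveOrderEmb]
  exact Finset.orderEmbOfFin_unique' _ fun x => by
    simp only [Finset.mem_compl, Finset.mem_singleton]
    rintro rfl
    exact hp ⟨x, rfl⟩

lemma augment_mul {ι : Type*} {k : ℕ} (Y : Matrix ι (Fin (k + 1)) ℝ)
    (C : Matrix (Fin (k + 1)) (Fin k) ℝ) (c : Fin (k + 1) → ℝ) (f : Fin (k + 1) → ι) :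
    augment (Y * C) (Y *ᵥ c) f = Y.submatrix f id * augment C c id := by
  ext i j
  refine Fin.cases ?_ (fun j => ?_) j <;> simp [augment, Matrix.mul_apply, Matrix.mulVec, dotProduct]

lemma det_augment_insertNth {ι : Type*} {k : ℕ} (Z : Matrix ι (Fin k) ℝ) (z : ι → ℝ) {t : ι}
    (hZ : ∀ j, Z t j = 0) (p : Fin (k + 1)) (g : Fin k → ι) :
    (augment Z z (p.insertNth t g)).det =
      (-1) ^ (p : ℕ) * z t * (Z.submatrix g id).det := by
  rw [Matrix.det_succ_row _ p, Fin.sum_univ_succ, Finset.sum_eq_zero, add_zero]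
  · have : (augment Z z (p.insertNth t g)).submatrix p.succAbove (0 : Fin (k + 1)).succAbove =
        Z.submatrix g id := by
      ext i j
      simp [augment]
    rw [this]
    simp [augment]
  · intro j _
    simp [augment, hZ]

lemma prod_ite_lt {k : ℕ} (p : Fin (k + 1)) (a : ℝ) :
    ∏ i : Fin k, (if i.castSucc < p then a else 1) = a ^ (p : ℕ) := by
  rw [show ∏ i : Fin k, (if i.castSucc < p then a else 1) =
      ∏ i ∈ Finset.range k, if i < (p : ℕ) then a else 1 from
    Fin.prod_univ_eq_prod_range (fun i => if i < (p : ℕ) then a else 1) k,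
    Finset.prod_ite, Finset.prod_const, Finset.prod_const_one, mul_one]
  congr 1
  have : (Finset.range k).filter (· < (p : ℕ)) = Finset.range p := by
    ext x
    simp
    omega
  rw [this, Finset.card_range]

/-! ### Minors of one weak sign bound the number of alternations. -/

/-- Vectors in a `k`-dimensional space whose Plücker coordinates have a common weak sign have fewer
than `k` sign changes. -/
theorem not_alternates_of_minors_nonneg {ι : Type*} [Fintype ι] [LinearOrder ι] {k : ℕ}
    (Y : Matrix ι (Fin k) ℝ) (hY : ∀ c, Y *ᵥ c = 0 → c = 0) (σ : ℝ) (hσ : σ ≠ 0)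
    (hmin : ∀ f : Fin k ↪o ι, 0 ≤ σ * (Y.submatrix f id).det) (c : Fin k → ℝ) :
    ¬ Alternates (Y *ᵥ c) k := by
  induction k generalizing σ with
  | zero =>
    rintro ⟨r, τ, h⟩
    simpa [Matrix.mulVec, dotProduct] using h 0
  | succ k ih =>
    rintro ⟨r, τ, h⟩
    -- Expanding the vanishing determinant of `Y` augmented by `Y c` along its first column gives a
    -- sum of terms of one sign, with nonzero entries of `Y c` as factors. Hence every minor in the
    -- rows `r` vanishes.
    have hzero : ∀ i : Fin (k + 2), (Y.submatrix (r ∘ i.succAbove) id).det = 0 := by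
      have h1 := det_augment_eq_zero Y c r
      rw [det_augment] at h1
      have h2 : ∑ i : Fin (k + 2), (τ * (-1) ^ (i : ℕ) * (Y *ᵥ c) (r i)) *
          (σ * (Y.submatrix (r ∘ i.succAbove) id).det) = 0 := by
        rw [← mul_zero (τ * σ), ← h1, Finset.mul_sum]
        exact Finset.sum_congr rfl fun i _ => by ring
      intro i
      have h3 := (Finset.sum_eq_zero_iff_of_nonneg fun i _ => mul_nonneg (h i).le
        (show 0 ≤ σ * (Y.submatrix (r ∘ i.succAbove) id).det from
          hmin (i.succAboveOrderEmb.trans r))).1 h2 i (Finset.mem_univ i)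
      exact (mul_eq_zero.1 ((mul_eq_zero.1 h3).resolve_left (h i).ne')).resolve_left hσ
    obtain ⟨c0, hc0r, hc0⟩ : ∃ c0, Y.submatrix r id *ᵥ c0 = 0 ∧ c0 ≠ 0 := by
      by_contra hcon
      push Not at hcon
      obtain ⟨f, hf⟩ := exists_minor_ne_zero _ hcon
      obtain ⟨p, rfl⟩ := exists_eq_succAboveOrderEmb f
      exact hf (hzero p)
    have hzr : ∀ i, (Y *ᵥ c0) (r i) = 0 := fun i => congrFun hc0r i
    -- Adding multiples of `Y c0` does not affect the rows `r`, so the entry at `t` can be cleared,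
    -- which lowers the dimension by one.
    obtain ⟨t, ht⟩ : ∃ t, (Y *ᵥ c0) t ≠ 0 := by
      by_contra hcon
      push Not at hcon
      exact hc0 (hY c0 (funext hcon))
    let ℓ : (Fin (k + 1) → ℝ) →ₗ[ℝ] ℝ := LinearMap.proj t ∘ₗ Y.mulVecLin
    have hℓ : ∀ x, ℓ x = (Y *ᵥ x) t := fun x => rfl
    obtain ⟨C, hCinj, hC⟩ := exists_kernel_matrix ℓ fun h0 => ht (by rw [← hℓ, h0]; rfl)
    have hZt : ∀ d, ((Y * C) *ᵥ d) t = 0 := fun d => by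
      rw [← Matrix.mulVec_mulVec, ← hℓ]
      exact (hC _).2 ⟨d, rfl⟩
    have hZt' : ∀ j, (Y * C) t j = 0 := fun j => by
      simpa using hZt (Pi.single j 1)
    -- Since `c0` lies outside `ker ℓ`, it completes the columns of `C` to a basis.
    have hP : (augment C c0 id).det ≠ 0 := by
      intro h0
      obtain ⟨w, hw0, hw⟩ := Matrix.exists_mulVec_eq_zero_iff.2 h0
      obtain ⟨b, d, rfl⟩ : ∃ b d, w = Fin.cons b d := ⟨w 0, Fin.tail w, (Fin.cons_self_tail w).symm⟩
      have hw' : b • c0 + C *ᵥ d = 0 := by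
        ext i
        have := congrFun hw i
        rw [augment_mulVec] at this
        simpa [mul_comm] using this
      have hb : b = 0 := by
        have h1 := congrArg ℓ hw'
        rw [map_add, map_smul, (hC _).2 ⟨d, rfl⟩, map_zero, add_zero, hℓ] at h1
        simpa [ht] using h1
      subst hb
      have hd : d = 0 := hCinj d (by simpa using hw')
      subst hd
      apply hw0
      ext i
      refine Fin.cases ?_ (fun i => ?_) i <;> simp
    -- Inserting row `t` into the rows `g` costs the sign `(-1) ^ p`, with `p` the number of rows
    -- before `t`. Flipping all rows before `t` cancels it, so the minors of `Z` again share a weak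
    -- sign.
    let s : ι → ℝ := fun i => if i < t then -1 else 1
    have hs : ∀ i, s i ≠ 0 := fun i => by simp only [s]; split_ifs <;> norm_num
    let Z : Matrix ι (Fin k) ℝ := Matrix.of fun i j => s i * (Y * C) i j
    have hZ : ∀ d i, (Z *ᵥ d) i = s i * (Y *ᵥ (C *ᵥ d)) i := fun d i => by
      rw [Matrix.mulVec_mulVec]
      simp [Z, Matrix.mulVec, dotProduct, Finset.mul_sum, mul_assoc]
    have hZinj : ∀ d, Z *ᵥ d = 0 → d = 0 := fun d hd => by
      apply hCinj
      apply hY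
      ext i
      have := congrFun hd i
      rw [hZ] at this
      simpa [hs] using this
    have hdet : ∀ g : Fin k ↪o ι, (Z.submatrix g id).det =
        (∏ i, s (g i)) * ((Y * C).submatrix g id).det := fun g =>
      Matrix.det_mul_column (fun i => s (g i)) ((Y * C).submatrix g id)
    -- This subtracts the multiple of `c0` that clears entry `t` of `Y c`.
    obtain ⟨d, hd⟩ := (hC (c - ((Y *ᵥ c) t / (Y *ᵥ c0) t) • c0)).1 (by
      rw [hℓ, Matrix.mulVec_sub, Matrix.mulVec_smul]
      simp [ht])
    have hZd : ∀ i, (Z *ᵥ d) (r i) = s (r i) * (Y *ᵥ c) (r i) := fun i => by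
      rw [hZ, hd, Matrix.mulVec_sub, Matrix.mulVec_smul]
      simp [hzr]
    refine ih Z hZinj (σ * (augment C c0 id).det * (Y *ᵥ c0) t)
      (mul_ne_zero (mul_ne_zero hσ hP) ht) (fun g => ?_) d ?_
    · by_cases htg : t ∈ Set.range g
      · obtain ⟨i, hi⟩ := htg
        rw [Matrix.det_eq_zero_of_row_eq_zero i, mul_zero]
        intro j
        simp [Z, hi, hZt']
      · obtain ⟨p, hp1, hp2⟩ := exists_cut g t
        have hp3 : ∀ i : Fin k, p ≤ i.castSucc → t < g i := fun i hi =>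
          lt_of_le_of_ne (hp2 i hi) fun h => htg ⟨i, h.symm⟩
        have hmono : StrictMono (p.insertNth t g : Fin (k + 1) → ι) :=
          (Fin.strictMono_insertNth_iff p t g).2 ⟨g.strictMono, hp1, hp3⟩
        have hprod : ∏ i, s (g i) = (-1) ^ (p : ℕ) := by
          rw [← prod_ite_lt]
          refine Finset.prod_congr rfl fun i _ => ?_
          simp only [s]
          by_cases hi : i.castSucc < p
          · rw [if_pos hi, if_pos (hp1 i hi)]
          · rw [if_neg hi, if_neg (hp2 i (not_lt.1 hi)).not_gt]
        have h1 := det_augment_insertNth (Y * C) (Y *ᵥ c0) hZt' p g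
        rw [augment_mul, Matrix.det_mul] at h1
        have h2 := hmin (OrderEmbedding.ofStrictMono _ hmono)
        rw [OrderEmbedding.coe_ofStrictMono] at h2
        rw [hdet, hprod]
        calc (0 : ℝ) ≤ (σ * (Y.submatrix (p.insertNth t g : Fin (k + 1) → ι) id).det) *
              ((augment C c0 id).det * (augment C c0 id).det) :=
              mul_nonneg h2 (mul_self_nonneg _)
          _ = _ := by linear_combination (σ * (augment C c0 id).det) * h1
    · obtain ⟨p, hp1, hp2⟩ := exists_cut r t
      -- The flip breaks the alternation only across `t`. Dropping the first index of `r` not before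
      -- `t`, or the last one if all are before `t`, restores it at the cost of one sign change.
      have key : ∃ q : Fin (k + 2), ∀ i : Fin (k + 1),
          (i.castSucc < q → i.castSucc.castSucc < p) ∧ (q ≤ i.castSucc → p ≤ i.succ.castSucc) := by
        refine ⟨⟨min p (k + 1), by omega⟩, fun i => ?_⟩
        simp only [Fin.lt_def, Fin.le_def, Fin.val_castSucc, Fin.val_succ]
        omega
      obtain ⟨q, hq⟩ := key
      refine ⟨q.succAboveOrderEmb.trans r, -τ, fun i => ?_⟩
      rw [RelEmbedding.trans_apply, Fin.succAboveOrderEmb_apply, hZd]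
      rcases lt_or_ge i.castSucc q with hi | hi
      · rw [Fin.succAbove_of_castSucc_lt _ _ hi]
        have := h i.castSucc
        simp only [s, if_pos (hp1 _ ((hq i).1 hi))]
        simpa using this
      · rw [Fin.succAbove_of_le_castSucc _ _ hi]
        have := h i.succ
        simp only [s, if_neg (hp2 _ ((hq i).2 hi)).not_gt]
        simpa [pow_succ] using this

/-! ### Splitting a vector into blocks of constant weak sign. -/

/-- `u` alternates along an increasing sequence of `q + 1` indices that are at most `j`. -/
def AlternatesUpTo {m : ℕ} (u : Fin m → ℝ) (j : Fin m) (q : ℕ) : Prop :=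
  ∃ r : Fin (q + 1) ↪o Fin m, ∃ τ : ℝ,
    (∀ i : Fin (q + 1), 0 < τ * (-1) ^ (i : ℕ) * u (r i)) ∧ r (Fin.last q) ≤ j

lemma AlternatesUpTo.alternates {m : ℕ} {u : Fin m → ℝ} {j : Fin m} {q : ℕ}
    (h : AlternatesUpTo u j q) : Alternates u q := by
  obtain ⟨r, τ, h, -⟩ := h
  exact ⟨r, τ, h⟩

lemma AlternatesUpTo.mono {m : ℕ} {u : Fin m → ℝ} {i j : Fin m} {q : ℕ} (hij : i ≤ j)
    (h : AlternatesUpTo u i q) : AlternatesUpTo u j q := by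
  obtain ⟨r, τ, h, hr⟩ := h
  exact ⟨r, τ, h, hr.trans hij⟩

lemma AlternatesUpTo.zero {m : ℕ} {u : Fin m → ℝ} {j : Fin m} (h : u j ≠ 0) :
    AlternatesUpTo u j 0 :=
  ⟨OrderEmbedding.ofStrictMono (fun _ : Fin 1 => j) 
    (fun a b hab => absurd hab (by omega)), u j,
    fun i => by
      obtain rfl : i = 0 := Subsingleton.elim (α := Fin 1) _ _
      rw [Fin.val_zero, pow_zero, mul_one]
      exact mul_self_pos.2 h, le_rfl⟩

lemma AlternatesUpTo.snoc {m : ℕ} {u : Fin m → ℝ} {q : ℕ} (r : Fin (q + 1) ↪o Fin m) {τ : ℝ}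
    (h : ∀ i : Fin (q + 1), 0 < τ * (-1) ^ (i : ℕ) * u (r i)) {x : Fin m}
    (hx : r (Fin.last q) < x) (hux : τ * (-1) ^ q * u x < 0) : AlternatesUpTo u x (q + 1) := by
  have hmono : StrictMono ((Fin.last (q + 1)).insertNth x r : Fin (q + 1 + 1) → Fin m) :=
    (Fin.strictMono_insertNth_iff _ x r).2
      ⟨r.strictMono, fun i _ => (r.monotone (Fin.le_last i)).trans_lt hx,
        fun i hi => absurd hi (Fin.castSucc_lt_last i).not_ge⟩
  refine ⟨OrderEmbedding.ofStrictMono _ hmono, τ, fun i => ?_, ?_⟩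
  · rw [OrderEmbedding.coe_ofStrictMono]
    refine Fin.lastCases ?_ (fun i => ?_) i
    · simp only [Fin.insertNth_apply_same, Fin.val_last, pow_succ]
      linarith
    · simpa [Fin.insertNth_last'] using h i
  · simp [OrderEmbedding.coe_ofStrictMono]

open Classical in
/-- The largest number of alternations of `u` up to index `j`, capped at `k`. -/
noncomputable def alternationLevel {m : ℕ} (u : Fin m → ℝ) (k : ℕ) (j : Fin m) : ℕ :=
  Nat.findGreatest (AlternatesUpTo u j) k

open Classical in
lemma alternationLevel_mono {m : ℕ} (u : Fin m → ℝ) (k : ℕ) : Monotone (alternationLevel u k) := by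
  intro i j hij
  exact Nat.findGreatest_mono (fun q h => h.mono hij) le_rfl

open Classical in
-- Level `0` is also the default of `Nat.findGreatest` when `u` vanishes up to `j`; the hypothesis
-- excludes that case.
lemma alternatesUpTo_level {m : ℕ} (u : Fin m → ℝ) (k : ℕ) {j : Fin m}
    (hj : alternationLevel u k j ≠ 0 ∨ u j ≠ 0) :
    AlternatesUpTo u j (alternationLevel u k j) := by
  by_cases h : alternationLevel u k j = 0
  · rw [h]
    exact AlternatesUpTo.zero (hj.resolve_left (not_not.2 h))
  · exact Nat.findGreatest_of_ne_zero rfl h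

open Classical in
lemma alternationLevel_lt {m : ℕ} {u : Fin m → ℝ} {k : ℕ} (hk : 1 ≤ k) (h : ¬ Alternates u k)
    (j : Fin m) : alternationLevel u k j < k := by
  refine lt_of_le_of_ne (Nat.findGreatest_le k) fun heq => h ?_
  have := alternatesUpTo_level u k (j := j) (Or.inl (by omega))
  rw [heq] at this
  exact this.alternates

open Classical in
lemma mul_nonneg_of_level_eq {m : ℕ} {u : Fin m → ℝ} {k : ℕ} (hk : 1 ≤ k) (h : ¬ Alternates u k)
    {i j : Fin m} (hij : i < j) (heq : alternationLevel u k i = alternationLevel u k j) :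
    0 ≤ u i * u j := by
  by_contra hneg
  push Not at hneg
  have hi : u i ≠ 0 := by rintro h0; simp [h0] at hneg
  have hmax : ∀ x, AlternatesUpTo u x (alternationLevel u k x + 1) → False := fun x hx => by
    have : alternationLevel u k x + 1 ≤ alternationLevel u k x :=
      Nat.le_findGreatest (alternationLevel_lt hk h x) hx
    omega
  have hlevel := alternatesUpTo_level u k (Or.inr hi)
  set q := alternationLevel u k i
  obtain ⟨r, τ, hr, hlast⟩ := hlevel
  have hτ : τ * (-1) ^ q ≠ 0 := fun h0 => by simpa [h0] using hr (Fin.last q)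
  -- If `u i` opposes the last sign of the alternation, `i` extends it; if it agrees, `j` extends
  -- it. Either contradicts maximality of the level.
  rcases lt_trichotomy (τ * (-1) ^ q * u i) 0 with h1 | h1 | h1
  · refine hmax i (AlternatesUpTo.snoc r hr (lt_of_le_of_ne hlast ?_) h1)
    intro he
    have := hr (Fin.last q)
    rw [he, Fin.val_last] at this
    linarith
  · exact hi ((mul_eq_zero.1 h1).resolve_left hτ)
  · refine hmax j ?_
    rw [← heq]
    refine AlternatesUpTo.snoc r hr (hlast.trans_lt hij) ?_
    have h2 := mul_neg_of_pos_of_neg h1 hneg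
    by_contra h3
    nlinarith [mul_nonneg (not_lt.1 h3) (mul_self_nonneg (u i))]

/-- A vector with fewer than `k` sign changes splits into `k` nonempty consecutive blocks on each
of which it has a weakly constant sign. -/
theorem exists_blocks {m k : ℕ} {u : Fin m → ℝ} (hk : 1 ≤ k) (hkm : k ≤ m)
    (h : ¬ Alternates u k) :
    ∃ B : Fin m → Fin k, Monotone B ∧ Function.Surjective B ∧
      ∀ i j, B i = B j → 0 ≤ u i * u j := by
  classical
  set N := alternationLevel u k with hN
  -- Blocks start where the level jumps, at most `k` places; `C` adds arbitrary further starts to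
  -- make exactly `k`.
  let C0 : Finset (Fin m) := Finset.univ.filter fun j => ∀ i < j, N i < N j
  have hC0 : C0.card ≤ k := by
    rw [← Finset.card_range k]
    refine Finset.card_le_card_of_injOn N (fun j _ => ?_) fun i hi j hj hij => ?_
    · simpa using alternationLevel_lt hk h j
    · have hi' := (Finset.mem_filter.1 hi).2
      have hj' := (Finset.mem_filter.1 hj).2
      rcases lt_trichotomy i j with hlt | heq | hlt
      · exact absurd hij (hj' i hlt).ne
      · exact heq
      · exact absurd hij.symm (hi' j hlt).ne
  obtain ⟨C, hsub, hC⟩ := Finset.exists_superset_card_eq hC0 (by simpa using hkm)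
  let J := C.orderEmbOfFin hC
  have hJ : ∀ x ∈ C, ∃ b, J b = x := fun x hx => by
    have : x ∈ Set.range J := by rw [Finset.range_orderEmbOfFin]; exact hx
    exact this
  have hB : ∀ j, ∃ b, J b ≤ j ∧ ∀ b', J b' ≤ j → b' ≤ b := fun j => by
    have hm : 0 < m := by omega
    obtain ⟨b0, hb0⟩ := hJ ⟨0, hm⟩ (hsub (Finset.mem_filter.2 ⟨Finset.mem_univ _,
      fun i hi => absurd hi (Nat.not_lt_zero _)⟩))
    have hne : (Finset.univ.filter fun b => J b ≤ j).Nonempty :=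
      ⟨b0, by simp only [Finset.mem_filter_univ, hb0]; exact Nat.zero_le _⟩
    refine ⟨_, (Finset.mem_filter.1 (Finset.max'_mem _ hne)).2, fun b' hb' => ?_⟩
    exact Finset.le_max' _ _ (by simpa using hb')
  choose B hB1 hB2 using hB
  refine ⟨B, fun i j hij => hB2 j _ ((hB1 i).trans hij), fun b => ⟨J b, ?_⟩, ?_⟩
  · exact le_antisymm (J.le_iff_le.1 (hB1 _)) (hB2 _ _ le_rfl)
  · have key : ∀ i j, i < j → B i = B j → 0 ≤ u i * u j := fun i j hij hBij => by
      refine mul_nonneg_of_level_eq hk h hij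
        (le_antisymm (alternationLevel_mono u k hij.le) (not_lt.1 fun hlt => ?_))
      have hne : (Finset.univ.filter fun x => N x = N j).Nonempty := ⟨j, by simp⟩
      set j' := Finset.min' _ hne with hj'
      have h1 : N j' = N j := (Finset.mem_filter.1 (Finset.min'_mem _ hne)).2
      have h2 : ∀ x, N x = N j → j' ≤ x := fun x hx => Finset.min'_le _ _ (by simpa using hx)
      have hij' : i < j' := by
        by_contra hcon
        have := alternationLevel_mono u k (not_lt.1 hcon)
        rw [← hN, h1] at this
        exact absurd hlt this.not_gt
      obtain ⟨b, hb⟩ := hJ j' (hsub (Finset.mem_filter.2 ⟨Finset.mem_univ _, fun x hx =>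
        lt_of_le_of_ne (alternationLevel_mono u k hx.le) fun he =>
          absurd hx (h2 x (he.trans h1)).not_gt⟩))
      have h3 := hB2 j b (hb ▸ h2 j rfl)
      rw [← hBij] at h3
      have := (J.monotone h3).trans (hB1 i)
      rw [hb] at this
      exact absurd hij' this.not_gt
    intro i j hij
    rcases lt_trichotomy i j with hlt | rfl | hlt
    · exact key i j hlt hij
    · exact mul_self_nonneg _
    · rw [mul_comm]
      exact key j i hlt hij.symm

/-- A vector with fewer than `k` sign changes is a blockwise nonnegative combination, with block
coefficients `s` and strictly positive weight somewhere in each of `k` consecutive blocks. -/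
lemma exists_weighted_blocks {m k : ℕ} {u : Fin m → ℝ} (hk : 1 ≤ k) (hkm : k ≤ m)
    (h : ¬ Alternates u k) :
    ∃ (B : Fin m → Fin k) (w : Fin m → ℝ) (s : Fin k → ℝ), Monotone B ∧ (∀ j, 0 ≤ w j) ∧
      (∀ b, ∃ j, B j = b ∧ 0 < w j) ∧ ∀ j, u j = s (B j) * w j := by
  classical
  obtain ⟨B, hmono, hsurj, hB⟩ := exists_blocks hk hkm h
  -- A block on which `u` vanishes gets weight `1` and coefficient `0`, so that it still contributes
  -- a nonzero column.
  refine ⟨B, fun j => if ∃ i, B i = B j ∧ u i ≠ 0 then |u j| else 1,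
    fun b => if ∃ i, B i = b ∧ u i ≠ 0 then (if ∃ i, B i = b ∧ u i < 0 then -1 else 1) else 0,
    hmono, fun j => by dsimp only; split_ifs <;> positivity, fun b => ?_, fun j => ?_⟩
  · by_cases hb : ∃ i, B i = b ∧ u i ≠ 0
    · obtain ⟨i, rfl, hi⟩ := hb
      refine ⟨i, rfl, ?_⟩
      dsimp only
      rw [if_pos ⟨i, rfl, hi⟩]
      exact abs_pos.2 hi
    · obtain ⟨j, rfl⟩ := hsurj b
      exact ⟨j, rfl, by dsimp only; rw [if_neg hb]; exact one_pos⟩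
  · dsimp only
    split_ifs with h1 h2
    · obtain ⟨i, hi, hneg⟩ := h2
      have := hB i j hi
      have h3 : u j ≤ 0 := by
        by_contra hcon
        nlinarith [mul_neg_of_neg_of_pos hneg (not_le.1 hcon)]
      rw [abs_of_nonpos h3]
      ring
    · push Not at h2
      rw [abs_of_nonneg (h2 j rfl), one_mul]
    · push Not at h1
      rw [h1 j rfl, zero_mul]

/-! ### Sign consistency implies variation bounding. -/

/-- Expansion of the minors of a matrix whose columns are weighted sums of columns of `X`. -/
lemma det_weighted_sum {n m k : ℕ} (X : Matrix (Fin n) (Fin m) ℝ) (w : Fin m → Fin k → ℝ)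
    (f : Fin k → Fin n) :
    ((X * Matrix.of w).submatrix f id).det =
      ∑ φ : Fin k → Fin m, (∏ b, w (φ b) b) * (X.submatrix f φ).det := by
  rw [← Matrix.det_transpose]
  have h1 : ((X * Matrix.of w).submatrix f id)ᵀ =
      fun b => ∑ j, w j b • fun i => X (f i) j := by
    ext b i
    simp [Matrix.mul_apply, Finset.sum_apply, mul_comm]
  rw [h1]
  have h2 := (Matrix.detRowAlternating (n := Fin k) (R := ℝ)).toMultilinearMap.map_sum
    (fun b j => w j b • fun i => X (f i) j)
  refine h2.trans (Finset.sum_congr rfl fun φ _ => ?_)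
  rw [MultilinearMap.map_smul_univ, smul_eq_mul, ← Matrix.det_transpose (X.submatrix f φ)]
  rfl

theorem IsSignConsistent.isVariationBounding {n m : ℕ} {X : Matrix (Fin n) (Fin m) ℝ} {k : ℕ}
    (hk : 1 ≤ k) (hkm : k ≤ m)
    (hcols : ∀ φ : Fin k ↪o Fin m, ∀ d, X.submatrix id φ *ᵥ d = 0 → d = 0)
    (hX : IsSignConsistent X k) : IsVariationBounding X (k - 1) := by
  obtain ⟨σ, hσ, hmin⟩ : ∃ σ : ℝ, σ ≠ 0 ∧ ∀ (I : Fin k ↪o Fin n) (J : Fin k ↪o Fin m),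
      0 ≤ σ * (X.submatrix I J).det := by
    rcases hX with h | h
    · exact ⟨1, one_ne_zero, fun I J => by simpa using! h I J⟩
    · exact ⟨-1, by norm_num, fun I J => by simpa using! h I J⟩
  rw [isVariationBounding_iff, Nat.sub_add_cancel hk]
  intro u _ hXu
  by_contra hu
  obtain ⟨B, w, s, hB, hw, hpos, hus⟩ := exists_weighted_blocks hk hkm hu
  let W : Fin m → Fin k → ℝ := fun j b => if B j = b then w j else 0
  have hW : ∀ j b, 0 ≤ W j b := fun j b => by
    simp only [W]; split_ifs; exacts [hw j, le_rfl]
  have hterm : ∀ (f : Fin k ↪o Fin n) (φ : Fin k → Fin m),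
      0 ≤ σ * ((∏ b, W (φ b) b) * (X.submatrix f φ).det) := fun f φ => by
    by_cases hφ : ∀ b, B (φ b) = b
    · have hm : StrictMono φ := fun a b hab => by
        by_contra hcon
        have := hB (not_lt.1 hcon)
        rw [hφ, hφ] at this
        exact absurd hab this.not_gt
      have h1 := hmin f (OrderEmbedding.ofStrictMono φ hm)
      rw [OrderEmbedding.coe_ofStrictMono] at h1
      rw [mul_left_comm]
      exact mul_nonneg (Finset.prod_nonneg fun b _ => hW _ _) h1
    · push Not at hφ
      obtain ⟨b, hb⟩ := hφ
      rw [Finset.prod_eq_zero (Finset.mem_univ b) (if_neg hb)]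
      simp
  have hYmin : ∀ f : Fin k ↪o Fin n, 0 ≤ σ * ((X * Matrix.of W).submatrix f id).det := fun f => by
    rw [det_weighted_sum, Finset.mul_sum]
    exact Finset.sum_nonneg fun φ _ => hterm f φ
  choose φ hφ1 hφ2 using hpos
  have hφ : StrictMono φ := fun a b hab => by
    by_contra hcon
    have := hB (not_lt.1 hcon)
    rw [hφ1, hφ1] at this
    exact absurd hab this.not_gt
  obtain ⟨f, hf⟩ := exists_minor_ne_zero _ (hcols (OrderEmbedding.ofStrictMono φ hφ))
  have hYf : ((X * Matrix.of W).submatrix f id).det ≠ 0 := by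
    intro h0
    have h1 : ∑ ψ : Fin k → Fin m, σ * ((∏ b, W (ψ b) b) * (X.submatrix f ψ).det) = 0 := by
      rw [← Finset.mul_sum, ← det_weighted_sum, h0, mul_zero]
    have h2 := (Finset.sum_eq_zero_iff_of_nonneg fun ψ _ => hterm f ψ).1 h1 φ (Finset.mem_univ _)
    have h3 : ∏ b, W (φ b) b ≠ 0 := Finset.prod_ne_zero_iff.2 fun b _ => by
      simp only [W, if_pos (hφ1 b)]
      exact (hφ2 b).ne'
    exact (mul_ne_zero hσ (mul_ne_zero h3 hf)) h2
  refine not_alternates_of_minors_nonneg (X * Matrix.of W)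
    (fun c hc => mulVec_eq_zero_of_minor_ne_zero hYf fun i => congrFun hc _) σ hσ hYmin s ?_
  have : (X * Matrix.of W) *ᵥ s = X *ᵥ u := by
    rw [← Matrix.mulVec_mulVec]
    congr 1
    ext j
    simp [Matrix.mulVec, dotProduct, W, hus, mul_comm]
  rwa [this]

/-! ### One weak sign for the minors of `k` fixed columns. -/

/-- Each exchange moves `I` one element closer to `I'` and takes place inside a set of `k + 1`
elements, where `s` is known to be invariant. -/
lemma Finset.exchange_iff {ι : Type*} [DecidableEq ι] (𝓑 : Finset ι → Prop) {k : ℕ}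
    (hcard : ∀ I, 𝓑 I → I.card = k)
    (hex : ∀ I I', 𝓑 I → 𝓑 I' → ∀ a ∈ I, a ∉ I' → ∃ b ∈ I', b ∉ I ∧ 𝓑 (insert b (I.erase a)))
    (s : Finset ι → Prop)
    (hs : ∀ R : Finset ι, R.card = k + 1 → ∀ a ∈ R, ∀ b ∈ R, 𝓑 (R.erase a) → 𝓑 (R.erase b) →
      (s (R.erase a) ↔ s (R.erase b)))
    {I I' : Finset ι} (hI : 𝓑 I) (hI' : 𝓑 I') : s I ↔ s I' := by
  obtain ⟨n, hn⟩ : ∃ n, (I \ I').card = n := ⟨_, rfl⟩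
  induction n generalizing I with
  | zero =>
    have hsub : I ⊆ I' := Finset.sdiff_eq_empty_iff_subset.1 (Finset.card_eq_zero.1 hn)
    rw [Finset.eq_of_subset_of_card_le hsub (by rw [hcard I hI, hcard I' hI'])]
  | succ n ih =>
    obtain ⟨a, ha⟩ : (I \ I').Nonempty := Finset.card_pos.1 (by omega)
    obtain ⟨haI, haI'⟩ := Finset.mem_sdiff.1 ha
    obtain ⟨b, hbI', hbI, hb⟩ := hex I I' hI hI' a haI haI'
    have hab : a ≠ b := fun h => hbI (h ▸ haI)
    have h1 : (insert b I).erase b = I := Finset.erase_insert hbI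
    have h2 : (insert b I).erase a = insert b (I.erase a) :=
      Finset.erase_insert_of_ne hab.symm
    have h3 := hs (insert b I) (by rw [Finset.card_insert_of_notMem hbI, hcard I hI]) b
      (Finset.mem_insert_self _ _) a (Finset.mem_insert_of_mem haI) (by rwa [h1]) (by rwa [h2])
    rw [h1, h2] at h3
    refine h3.trans (ih hb ?_)
    have h4 : insert b (I.erase a) \ I' = (I \ I').erase a := by
      rw [Finset.insert_sdiff_of_mem _ hbI', Finset.erase_sdiff_comm]
    rw [h4, Finset.card_erase_of_mem ha, hn]
    rfl

lemma Finset.orderEmbOfFin_erase {ι : Type*} [LinearOrder ι] {k : ℕ} {R : Finset ι}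
    (hR : R.card = k + 1) (i : Fin (k + 1)) (h : (R.erase (R.orderEmbOfFin hR i)).card = k) :
    (R.erase (R.orderEmbOfFin hR i)).orderEmbOfFin h =
      i.succAboveOrderEmb.trans (R.orderEmbOfFin hR) := by
  symm
  refine Finset.orderEmbOfFin_unique' _ fun x => Finset.mem_erase.2 ⟨fun heq => ?_, ?_⟩
  · exact Fin.succAbove_ne i x ((R.orderEmbOfFin hR).injective heq)
  · exact Finset.orderEmbOfFin_mem _ hR _

lemma Finset.exists_orderEmbOfFin_eq {ι : Type*} [LinearOrder ι] {k : ℕ} {R : Finset ι}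
    (hR : R.card = k) {a : ι} (ha : a ∈ R) : ∃ i, R.orderEmbOfFin hR i = a := by
  have : a ∈ Set.range (R.orderEmbOfFin hR) := by rwa [Finset.range_orderEmbOfFin]
  exact this

/-- Start from unit weights and increase the weight at `a` or at `b` until the sum cancels. -/
lemma exists_pos_sum_eq_zero {N : ℕ} (D : Fin N → ℝ) {a b : Fin N} (ha : D a < 0) (hb : 0 < D b) :
    ∃ x : Fin N → ℝ, (∀ i, 0 < x i) ∧ ∑ i, x i * D i = 0 := by
  obtain ⟨p, q, hp, hq, h⟩ : ∃ p q : ℝ, 0 ≤ p ∧ 0 ≤ q ∧ p * D a + q * D b = -∑ i, D i := by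
    rcases le_total 0 (∑ i, D i) with h | h
    · refine ⟨(∑ i, D i) / (-D a), 0, div_nonneg h (by linarith), le_rfl, ?_⟩
      have := ha.ne
      field_simp
      ring
    · refine ⟨0, (-∑ i, D i) / D b, le_rfl, div_nonneg (by linarith) hb.le, ?_⟩
      have := hb.ne'
      field_simp
      ring
  refine ⟨fun i => 1 + (Pi.single a p : Fin N → ℝ) i + (Pi.single b q : Fin N → ℝ) i, fun i => ?_, ?_⟩
  · have h1 : 0 ≤ (Pi.single a p : Fin N → ℝ) i := by
      rw [Pi.single_apply]; split_ifs; exacts [hp, le_rfl]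
    have h2 : 0 ≤ (Pi.single b q : Fin N → ℝ) i := by
      rw [Pi.single_apply]; split_ifs; exacts [hq, le_rfl]
    dsimp only
    linarith
  · simp only [add_mul, one_mul, Finset.sum_add_distrib, Pi.single_apply, ite_mul, zero_mul,
      Finset.sum_ite_eq', Finset.mem_univ, if_true]
    linarith

/-- If no vector in the column space has `k` sign changes, then the `k × k` minors within any
`k + 1` rows do not have opposite signs. -/
lemma minors_mul_nonneg {ι : Type*} [LinearOrder ι] {k : ℕ} (Y : Matrix ι (Fin k) ℝ)
    (hY : ∀ c, ¬ Alternates (Y *ᵥ c) k) (r : Fin (k + 1) ↪o ι) (a b : Fin (k + 1)) :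
    0 ≤ (Y.submatrix (r ∘ a.succAbove) id).det * (Y.submatrix (r ∘ b.succAbove) id).det := by
  have key : ∀ a b : Fin (k + 1), (Y.submatrix (r ∘ a.succAbove) id).det < 0 →
      0 < (Y.submatrix (r ∘ b.succAbove) id).det → False := fun a b ha hb => by
    obtain ⟨x, hx, hsum⟩ := exists_pos_sum_eq_zero
      (fun i : Fin (k + 1) => (Y.submatrix (r ∘ i.succAbove) id).det) ha hb
    have hone : ∀ i : ℕ, (-1 : ℝ) ^ i * (-1) ^ i = 1 := fun i => by rw [← mul_pow]; simp
    -- The positive relation among the minors says that the alternating vector `(-1) ^ i * x i` lies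
    -- in the column space on these rows.
    have hdet : (augment (Y.submatrix r id) (fun i => (-1) ^ (i : ℕ) * x i) id).det = 0 := by
      rw [det_augment, ← hsum]
      refine Finset.sum_congr rfl fun i _ => ?_
      simp only [id, ← mul_assoc, hone, one_mul]
      rfl
    obtain ⟨c, hc⟩ := exists_eq_mulVec_of_det_augment hdet a (ne_of_lt ha)
    refine hY c ⟨r, 1, fun i => ?_⟩
    have : (Y *ᵥ c) (r i) = (-1) ^ (i : ℕ) * x i := hc i
    rw [this, one_mul, ← mul_assoc, hone, one_mul]
    exact hx i
  by_contra hneg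
  rcases mul_neg_iff.1 (not_le.1 hneg) with ⟨h1, h2⟩ | ⟨h1, h2⟩
  · exact key b a h2 h1
  · exact key a b h1 h2

lemma minor_ne_zero_of_injective {ι : Type*} {k : ℕ} {Y : Matrix ι (Fin k) ℝ} {f : Fin k → ι}
    (h : ∀ c, (∀ i, (Y *ᵥ c) (f i) = 0) → c = 0) : (Y.submatrix f id).det ≠ 0 := by
  intro h0
  obtain ⟨w, hw0, hw⟩ := Matrix.exists_mulVec_eq_zero_iff.2 h0
  exact hw0 (h w fun i => congrFun hw i)

/-- If no vector in the column space has `k` sign changes, then all `k × k` minors have the same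
weak sign. -/
theorem minors_nonneg_or_nonpos {ι : Type*} [LinearOrder ι] {k : ℕ} (Y : Matrix ι (Fin k) ℝ)
    (hY : ∀ c, ¬ Alternates (Y *ᵥ c) k) :
    (∀ f : Fin k ↪o ι, 0 ≤ (Y.submatrix f id).det) ∨
      ∀ f : Fin k ↪o ι, (Y.submatrix f id).det ≤ 0 := by
  -- The row bases, that is, the `k`-sets of rows with nonzero minor; vanishing minors fit either
  -- sign.
  let 𝓑 : Finset ι → Prop := fun I => I.card = k ∧ ∀ c, (∀ x ∈ I, (Y *ᵥ c) x = 0) → c = 0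
  let s : Finset ι → Prop := fun I =>
    ∀ h : I.card = k, 0 < (Y.submatrix (I.orderEmbOfFin h) id).det
  have hdet : ∀ I (h : I.card = k), 𝓑 I → (Y.submatrix (I.orderEmbOfFin h) id).det ≠ 0 :=
    fun I h hI => minor_ne_zero_of_injective fun c hc => hI.2 c fun x hx => by
      obtain ⟨i, rfl⟩ := Finset.exists_orderEmbOfFin_eq h hx
      exact hc i
  have hex : ∀ I I', 𝓑 I → 𝓑 I' → ∀ a ∈ I, a ∉ I' →
      ∃ b ∈ I', b ∉ I ∧ 𝓑 (insert b (I.erase a)) := by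
    intro I I' hI hI' a ha ha'
    obtain ⟨i, hi⟩ := Finset.exists_orderEmbOfFin_eq hI.1 ha
    have hunit : IsUnit (Y.submatrix (I.orderEmbOfFin hI.1) id).det := (hdet I hI.1 hI).isUnit
    -- On `I`, the vector `Y c` is the indicator of `a`; any `b` in `I'` where it is nonzero can
    -- replace `a`.
    obtain ⟨c, hc⟩ : ∃ c, Y.submatrix (I.orderEmbOfFin hI.1) id *ᵥ c = Pi.single i 1 :=
      ⟨(Y.submatrix (I.orderEmbOfFin hI.1) id)⁻¹ *ᵥ Pi.single i 1, by
        rw [Matrix.mulVec_mulVec, Matrix.mul_nonsing_inv _ hunit, Matrix.one_mulVec]⟩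
    have hca : (Y *ᵥ c) a = 1 := by
      have := congrFun hc i
      rw [Pi.single_eq_same] at this
      rw [← hi]
      exact this
    have hcI : ∀ x ∈ I, x ≠ a → (Y *ᵥ c) x = 0 := fun x hx hxa => by
      obtain ⟨j, rfl⟩ := Finset.exists_orderEmbOfFin_eq hI.1 hx
      have := congrFun hc j
      rw [Pi.single_eq_of_ne (fun hji => hxa (by rw [hji, hi]))] at this
      exact this
    have hc0 : c ≠ 0 := by rintro rfl; simp at hca
    obtain ⟨b, hb, hcb⟩ : ∃ b ∈ I', (Y *ᵥ c) b ≠ 0 := by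
      by_contra hcon
      push Not at hcon
      exact hc0 (hI'.2 c hcon)
    have hba : b ≠ a := fun h => ha' (h ▸ hb)
    have hbI : b ∉ I := fun h => hcb (hcI b h hba)
    refine ⟨b, hb, hbI, ?_, fun d hd => ?_⟩
    · rw [Finset.card_insert_of_notMem fun h => hbI (Finset.mem_of_mem_erase h),
        Finset.card_erase_add_one ha, hI.1]
    · have h1 : d - ((Y *ᵥ d) a) • c = 0 := by
        apply hI.2
        intro x hx
        rw [Matrix.mulVec_sub, Matrix.mulVec_smul]
        by_cases hxa : x = a
        · subst hxa
          simp [hca]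
        · simp [hcI x hx hxa,
            hd x (Finset.mem_insert_of_mem (Finset.mem_erase.2 ⟨hxa, hx⟩))]
      rw [sub_eq_zero] at h1
      have h2 := hd b (Finset.mem_insert_self _ _)
      rw [h1, Matrix.mulVec_smul, Pi.smul_apply, smul_eq_mul] at h2
      rw [h1, (mul_eq_zero.1 h2).resolve_right hcb, zero_smul]
  have hs : ∀ R : Finset ι, R.card = k + 1 → ∀ a ∈ R, ∀ b ∈ R, 𝓑 (R.erase a) → 𝓑 (R.erase b) →
      (s (R.erase a) ↔ s (R.erase b)) := by
    intro R hR a ha b hb hBa hBb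
    obtain ⟨i, rfl⟩ := Finset.exists_orderEmbOfFin_eq hR ha
    obtain ⟨j, rfl⟩ := Finset.exists_orderEmbOfFin_eq hR hb
    have h1 := hdet _ hBa.1 hBa
    have h2 := hdet _ hBb.1 hBb
    have h3 := minors_mul_nonneg Y hY (R.orderEmbOfFin hR) i j
    simp only [s, forall_prop_of_true hBa.1, forall_prop_of_true hBb.1]
    rw [Finset.orderEmbOfFin_erase] at h1 h2 ⊢
    rw [Finset.orderEmbOfFin_erase]
    have h4 := lt_of_le_of_ne h3 (mul_ne_zero h1 h2).symm
    exact pos_iff_pos_of_mul_pos h4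
  have hmap : ∀ f : Fin k ↪o ι, ∃ (I : Finset ι) (h : I.card = k), I.orderEmbOfFin h = f :=
    fun f => ⟨Finset.univ.map f.toEmbedding, by simp,
      (Finset.orderEmbOfFin_unique' _ fun x => by simp).symm⟩
  have hB : ∀ I (h : I.card = k), (Y.submatrix (I.orderEmbOfFin h) id).det ≠ 0 → 𝓑 I :=
    fun I h h0 => ⟨h, fun c hc =>
      mulVec_eq_zero_of_minor_ne_zero h0 fun i => hc _ (Finset.orderEmbOfFin_mem _ _ _)⟩
  by_contra hcon
  push Not at hcon
  obtain ⟨⟨f, hf⟩, g, hg⟩ := hcon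
  obtain ⟨I, hI, rfl⟩ := hmap f
  obtain ⟨I', hI', rfl⟩ := hmap g
  have h1 := Finset.exchange_iff 𝓑 (fun I h => h.1) hex s hs (hB I hI hf.ne) (hB I' hI' hg.ne')
  exact absurd (h1.2 (fun _ => hg) hI) hf.not_gt

/-! ### Comparing the signs of different column sets. -/

lemma mulVec_extend {n m l : ℕ} (X : Matrix (Fin n) (Fin m) ℝ) (e : Fin l ↪o Fin m)
    (d : Fin l → ℝ) : X *ᵥ (Function.extend e d 0) = X.submatrix id e *ᵥ d := by
  ext x
  simp only [Matrix.mulVec, dotProduct, Matrix.submatrix_apply, id]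
  symm
  apply Finset.sum_of_injOn e e.injective.injOn (by simp)
  · intro j _ hj
    rw [Function.extend_apply' _ _ _ (by simpa using hj)]
    simp
  · intro i _
    rw [e.injective.extend_apply]

lemma Alternates.of_extend {m l k : ℕ} (e : Fin l ↪o Fin m) {d : Fin l → ℝ}
    (h : Alternates (Function.extend e d 0) k) : Alternates d k := by
  obtain ⟨r, τ, h⟩ := h
  have hr : ∀ i, ∃ j, e j = r i := fun i => by
    by_contra hcon
    have := h i
    rw [Function.extend_apply' _ _ _ hcon] at this
    simp at this
  choose ρ hρ using hr
  refine ⟨OrderEmbedding.ofStrictMono ρ fun i j hij => ?_, τ, fun i => ?_⟩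
  · rw [← e.lt_iff_lt, hρ, hρ]
    exact r.lt_iff_lt.2 hij
  · have := h i
    rw [← hρ, e.injective.extend_apply] at this
    exact this

lemma not_alternates_of_card {k : ℕ} (d : Fin k → ℝ) : ¬ Alternates d k := by
  rintro ⟨r, -⟩
  have := Fintype.card_le_of_injective r r.injective
  simp at this

lemma Alternates.pos_of_card {k : ℕ} {d : Fin (k + 1) → ℝ} (h : Alternates d k) :
    ∃ τ : ℝ, ∀ i : Fin (k + 1), 0 < τ * (-1) ^ (i : ℕ) * d i := by
  obtain ⟨r, τ, h⟩ := h
  refine ⟨τ, fun i => ?_⟩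
  have : r i = i := by
    have h1 := Finset.orderEmbOfFin_unique' (s := Finset.univ) (by simp) (f := r) (by simp)
    have h2 := Finset.orderEmbOfFin_unique' (s := Finset.univ) (by simp)
      (f := RelEmbedding.refl ((· ≤ ·) : Fin (k + 1) → Fin (k + 1) → Prop)) (by simp)
    rw [h1, ← h2]
    rfl
  simpa [this] using h i

section
variable {n m k : ℕ} {X : Matrix (Fin n) (Fin m) ℝ}

lemma column_minors_nonneg_or_nonpos (hX : ∀ u, Alternates (X *ᵥ u) k → Alternates u k)
    (φ : Fin k ↪o Fin m) :
    (∀ f : Fin k ↪o Fin n, 0 ≤ (X.submatrix f φ).det) ∨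
      ∀ f : Fin k ↪o Fin n, (X.submatrix f φ).det ≤ 0 :=
  minors_nonneg_or_nonpos (X.submatrix id φ) fun c hc =>
    not_alternates_of_card c (Alternates.of_extend φ (hX _ (by rwa [mulVec_extend])))

/-- Among `k + 1` independent columns, the sign of the minors does not depend on the omitted
column. -/
lemma nonneg_iff_of_independent (hX : ∀ u, Alternates (X *ᵥ u) k → Alternates u k)
    (e : Fin (k + 1) ↪o Fin m) (he : ∀ d, X.submatrix id e *ᵥ d = 0 → d = 0) (a b : Fin (k + 1)) :
    (∀ f : Fin k ↪o Fin n, 0 ≤ (X.submatrix f (a.succAboveOrderEmb.trans e)).det) ↔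
      ∀ f : Fin k ↪o Fin n, 0 ≤ (X.submatrix f (b.succAboveOrderEmb.trans e)).det := by
  obtain ⟨M, hM⟩ := exists_minor_ne_zero _ he
  set G : Matrix (Fin (k + 1)) (Fin (k + 1)) ℝ := (X.submatrix id e).submatrix M id with hG
  -- By Cramer's rule, `adj(G) y` solves the system with right-hand side `det G • y`, and its
  -- entries are `(-1) ^ i * T i`. As `y` alternates, so must this solution on all `k + 1` columns,
  -- which forces all `T i` to have one strict sign.
  let T : Fin (k + 1) → ℝ := fun i => ∑ x : Fin (k + 1),
    (X.submatrix (x.succAboveOrderEmb.trans M) (i.succAboveOrderEmb.trans e)).det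
  let y : Fin (k + 1) → ℝ := fun x => (-1) ^ (x : ℕ)
  have hone : ∀ i : ℕ, (-1 : ℝ) ^ i * (-1) ^ i = 1 := fun i => by rw [← mul_pow]; simp
  have hu : ∀ i, (G.adjugate *ᵥ y) i = (-1) ^ (i : ℕ) * T i := fun i => by
    simp only [Matrix.mulVec, dotProduct, T, Finset.mul_sum]
    refine Finset.sum_congr rfl fun x _ => ?_
    rw [Matrix.adjugate_fin_succ_eq_det_submatrix]
    have : G.submatrix x.succAbove i.succAbove =
        X.submatrix (x.succAboveOrderEmb.trans M) (i.succAboveOrderEmb.trans e) := rfl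
    rw [this, pow_add]
    simp only [y]
    linear_combination (-1) ^ (i : ℕ) *
      (X.submatrix (x.succAboveOrderEmb.trans M) (i.succAboveOrderEmb.trans e)).det * hone x
  have hGu : G *ᵥ (G.adjugate *ᵥ y) = G.det • y := by
    rw [Matrix.mulVec_mulVec, Matrix.mul_adjugate, Matrix.smul_mulVec, Matrix.one_mulVec]
  have halt : Alternates (X.submatrix id e *ᵥ (G.adjugate *ᵥ y)) k := by
    refine ⟨M, G.det, fun x => ?_⟩
    have h1 : (X.submatrix id e *ᵥ (G.adjugate *ᵥ y)) (M x) = G.det * (-1) ^ (x : ℕ) :=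
      congrFun hGu x
    rw [h1]
    have h2 := mul_self_pos.2 hM
    linear_combination h2 - G.det * G.det * hone x
  rw [← mulVec_extend] at halt
  obtain ⟨τ, hτ⟩ := (Alternates.of_extend e (hX _ halt)).pos_of_card
  have hT : ∀ i, 0 < τ * T i := fun i => by
    have := hτ i
    rw [hu] at this
    linear_combination this + τ * T i * hone i
  have hiff : ∀ i, (∀ f : Fin k ↪o Fin n,
      0 ≤ (X.submatrix f (i.succAboveOrderEmb.trans e)).det) ↔ 0 < T i := fun i => by
    have hT0 : T i ≠ 0 := fun h0 => by simpa [h0] using hT i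
    refine ⟨fun h => lt_of_le_of_ne (Finset.sum_nonneg fun x _ => h _) hT0.symm, fun h => ?_⟩
    refine (column_minors_nonneg_or_nonpos hX _).resolve_right fun hneg => ?_
    exact absurd h (Finset.sum_nonpos fun x _ => hneg _).not_gt
  rw [hiff, hiff, ← pos_iff_pos_of_mul_pos (hT a), ← pos_iff_pos_of_mul_pos (hT b)]

lemma submatrix_injective_of_linearIndepOn {l : ℕ} {K : Finset (Fin m)}
    (hK : LinearIndepOn ℝ X.col (K : Set (Fin m))) (e : Fin l ↪o Fin m) (he : ∀ i, e i ∈ K) :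
    ∀ d, X.submatrix id e *ᵥ d = 0 → d = 0 := by
  have h1 : LinearIndependent ℝ (X.submatrix id e).col :=
    LinearIndependent.comp hK (fun i => ⟨e i, he i⟩) fun i j hij =>
      e.injective (congrArg Subtype.val hij)
  exact fun d hd => Matrix.mulVec_injective_iff.2 h1 (by rw [hd, Matrix.mulVec_zero])

lemma nonneg_iff_erase (hX : ∀ u, Alternates (X *ᵥ u) k → Alternates u k) (hrank : k < X.rank)
    (hcols : ∀ J : Finset (Fin m), J.card = k → LinearIndepOn ℝ X.col (J : Set (Fin m)))
    (s : Finset (Fin m) → Prop)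
    (hs : ∀ J (h : J.card = k), s J ↔
      ∀ f : Fin k ↪o Fin n, 0 ≤ (X.submatrix f (J.orderEmbOfFin h)).det)
    (K : Finset (Fin m)) (hK : K.card = k + 1) (a : Fin m) (ha : a ∈ K) (b : Fin m) (hb : b ∈ K) :
    s (K.erase a) ↔ s (K.erase b) := by
  have hind : ∀ K : Finset (Fin m), K.card = k + 1 → LinearIndepOn ℝ X.col (K : Set (Fin m)) →
      ∀ a ∈ K, ∀ b ∈ K, (s (K.erase a) ↔ s (K.erase b)) := by
    intro K hK hli a ha b hb
    have hca : (K.erase a).card = k := by rw [Finset.card_erase_of_mem ha, hK]; rfl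
    have hcb : (K.erase b).card = k := by rw [Finset.card_erase_of_mem hb, hK]; rfl
    obtain ⟨i, rfl⟩ := Finset.exists_orderEmbOfFin_eq hK ha
    obtain ⟨j, rfl⟩ := Finset.exists_orderEmbOfFin_eq hK hb
    rw [hs _ hca, hs _ hcb, Finset.orderEmbOfFin_erase, Finset.orderEmbOfFin_erase]
    exact nonneg_iff_of_independent hX _
      (submatrix_injective_of_linearIndepOn hli _ fun i => Finset.orderEmbOfFin_mem _ _ _) i j
  by_cases hli : LinearIndepOn ℝ X.col (K : Set (Fin m))
  · exact hind K hK hli a ha b hb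
  by_cases hab : a = b
  · rw [hab]
  -- The `k + 1` dependent columns of `K` span at most `k < rank X` dimensions.
  obtain ⟨c, hc⟩ : ∃ c, X.col c ∉ Submodule.span ℝ (X.col '' (K : Set (Fin m))) := by
    by_contra hcon
    push Not at hcon
    have h1 : Submodule.span ℝ (Set.range X.col) ≤
        Submodule.span ℝ (X.col '' (K : Set (Fin m))) := by
      rw [Submodule.span_le]
      rintro _ ⟨c, rfl⟩
      exact hcon c
    have h2 := Submodule.finrank_mono h1
    rw [← Matrix.rank_eq_finrank_span_cols] at h2
    apply hli
    apply linearIndependent_iff_card_le_finrank_span.2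
    rw [Set.finrank, ← Set.image_eq_range]
    simp only [Finset.coe_sort_coe, Fintype.card_coe, hK]
    omega
  have hcK : c ∉ K := fun h => hc (Submodule.subset_span ⟨c, h, rfl⟩)
  have hins : ∀ x ∈ K, LinearIndepOn ℝ X.col ((insert c (K.erase x) : Finset (Fin m)) : Set _) ∧
      (insert c (K.erase x)).card = k + 1 := fun x hx => by
    have hcard : (K.erase x).card = k := by rw [Finset.card_erase_of_mem hx, hK]; rfl
    have hcx : c ∉ K.erase x := fun h => hcK (Finset.mem_of_mem_erase h)
    refine ⟨?_, by rw [Finset.card_insert_of_notMem hcx, hcard]⟩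
    rw [Finset.coe_insert]
    refine (hcols _ hcard).insert fun h => hc (Submodule.span_mono (Set.image_mono ?_) h)
    exact Finset.coe_subset.2 (Finset.erase_subset _ _)
  -- Both `K \ {a}` and `K \ {b}` are compared with `(K \ {a, b}) ∪ {c}`, each inside an independent
  -- `(k + 1)`-set.
  have hstep : ∀ x ∈ K, ∀ y ∈ K, x ≠ y →
      (s (K.erase x) ↔ s (insert c ((K.erase x).erase y))) := fun x hx y hy hxy => by
    have hcx : c ∉ K.erase x := fun h => hcK (Finset.mem_of_mem_erase h)
    have hcy : c ≠ y := fun h => hcK (h ▸ hy)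
    have h1 := hind _ (hins x hx).2 (hins x hx).1 c (Finset.mem_insert_self _ _) y
      (Finset.mem_insert_of_mem (Finset.mem_erase.2 ⟨hxy.symm, hy⟩))
    rwa [Finset.erase_insert hcx, Finset.erase_insert_of_ne hcy] at h1
  rw [hstep a ha b hb hab, hstep b hb a ha (Ne.symm hab), Finset.erase_right_comm]

theorem isSignConsistent_of_alternates (hX : ∀ u, Alternates (X *ᵥ u) k → Alternates u k)
    (hrank : k < X.rank)
    (hcols : ∀ J : Finset (Fin m), J.card = k → LinearIndepOn ℝ X.col (J : Set (Fin m))) :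
    IsSignConsistent X k := by
  let s : Finset (Fin m) → Prop := fun J =>
    ∀ (h : J.card = k) (f : Fin k ↪o Fin n), 0 ≤ (X.submatrix f (J.orderEmbOfFin h)).det
  have hs : ∀ J (h : J.card = k), s J ↔
      ∀ f : Fin k ↪o Fin n, 0 ≤ (X.submatrix f (J.orderEmbOfFin h)).det := fun J h =>
    forall_prop_of_true h
  have hall : ∀ I J : Finset (Fin m), I.card = k → J.card = k → (s I ↔ s J) := fun I J hI hJ => by
    refine Finset.exchange_iff (fun I => I.card = k) (fun _ h => h) ?_ s
      (fun R hR a ha b hb _ _ => nonneg_iff_erase hX hrank hcols s hs R hR a ha b hb) hI hJ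
    intro I I' hI hI' a ha ha'
    obtain ⟨b, hb, hbI⟩ : ∃ b ∈ I', b ∉ I := by
      by_contra hcon
      push Not at hcon
      have := Finset.eq_of_subset_of_card_le hcon (by rw [hI, hI'])
      exact ha' (this ▸ ha)
    refine ⟨b, hb, hbI, ?_⟩
    rw [Finset.card_insert_of_notMem fun h => hbI (Finset.mem_of_mem_erase h),
      Finset.card_erase_add_one ha, hI]
  have hmap : ∀ f : Fin k ↪o Fin m, ∃ (I : Finset (Fin m)) (h : I.card = k),
      I.orderEmbOfFin h = f :=
    fun f => ⟨Finset.univ.map f.toEmbedding, by simp,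
      (Finset.orderEmbOfFin_unique' _ fun x => by simp).symm⟩
  by_cases h : ∃ J : Finset (Fin m), J.card = k ∧ s J
  · obtain ⟨J, hJ, hsJ⟩ := h
    left
    intro I φ
    obtain ⟨J', hJ', rfl⟩ := hmap φ
    exact (hall J J' hJ hJ').1 hsJ hJ' I
  · push Not at h
    right
    intro I φ
    obtain ⟨J', hJ', rfl⟩ := hmap φ
    exact (column_minors_nonneg_or_nonpos hX _).resolve_left
      (fun hpos => h J' hJ' fun _ => hpos) I

end

theorem mainTheorem4 {n m : ℕ} (X : Matrix (Fin n) (Fin m) ℝ) (k : ℕ) (hk : 1 ≤ k)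
    (hrank : k < X.rank)
    (hcols : ∀ J : Finset (Fin m), J.card = k → LinearIndependent ℝ (fun j : J => X.col j)) :
    IsVariationBounding X (k - 1) ↔ IsSignConsistent X k := by
  have hcols' : ∀ J : Finset (Fin m), J.card = k → LinearIndepOn ℝ X.col (J : Set (Fin m)) := hcols
  have hkm : k ≤ m := by
    have := X.rank_le_width
    omega
  constructor
  · intro h
    rw [isVariationBounding_iff, Nat.sub_add_cancel hk] at h
    refine isSignConsistent_of_alternates (fun u hu => h u ?_ hu) hrank hcols'
    rintro rfl
    obtain ⟨r, τ, hr⟩ := hu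
    simpa using hr 0
  · refine fun h => h.isVariationBounding hk hkm fun φ => ?_
    exact submatrix_injective_of_linearIndepOn (hcols' (Finset.univ.map φ.toEmbedding) (by simp)) φ
      fun i => by simp
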